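/- A real random variable $X$ is sub-Gaussian with moment $B\ge 0$ if $\mathbb{E}[\exp(tX)]\le\exp(B^2t^2/2)$ for all $t\in\mathbb{R}$, and it is sub-Gaussian with relative moment $\rho$ if this holds with $B=\rho\sqrt{\mathbb{E}[X^2]}$. A probability distribution $D$ on $\mathbb{R}^d$ is independently sub-Gaussian with relative moment $\rho$ if there is an orthonormal basis $a_1,\dots,a_d$ of $\mathbb{R}^d$ such that, for $X\sim D$, the random variables $\langle X,a_1\rangle,\dots,\langle X,a_d\rangle$ are independent and each is sub-Gaussian with relative moment $\rho$. For a real symmetric matrix $A$, let $\lambda_k(A)$ denote its $k$-th largest eigenvalue, counted with multiplicity. Theorem. Let $\rho>0$. There is a constant $\beta>0$, depending only on $\rho$, such that for every $\delta\in(0,1)$ there is a number $L_0$, depending only on $\rho$ and $\delta$, with the following property. For every dimension $d$, every distribution $D$ on $\mathbb{R}^d$ that is independently sub-Gaussian with relative moment $\rho$ and whose covariance matrix $\Sigma$ satisfies $\Sigma\preceq I$ (that is, $I-\Sigma$ is positive semidefinite) and $\operatorname{tr}(\Sigma)\ge L_0$, and every integer $m\ge 1$ with $m\le\beta\cdot\operatorname{tr}(\Sigma)$,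 \[ \mathbb{P}\big[\lambda_m(X_mX_m^{\top})\ge m\big]\ \ge\ 1-\delta , \] where $X_m$ is the random $m\times d$ matrix whose rows are independent draws from $D$. -/

import Mathlib

open MeasureTheory ProbabilityTheory

noncomputable section

/-- A real random variable `X` is sub-Gaussian with moment `B ≥ 0`:
`𝔼[exp (t X)] ≤ exp (B² t² / 2)` for all real `t`. Mathlib's `HasSubgaussianMGF X c` takes the
variance proxy `c = B²` and includes the finiteness of the expectations on the left. -/
def IsSubGaussian {Ω : Type*} [MeasurableSpace Ω] (X : Ω → ℝ) (B : ℝ) (μ : Measure Ω) : Prop :=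
  0 ≤ B ∧ HasSubgaussianMGF X (B.toNNReal ^ 2) μ

/-- `X` is sub-Gaussian with relative moment `ρ = B / √𝔼[X²]`. The relation between `B` and `ρ` is
written without division, so that a variable that vanishes almost surely qualifies (with `B = 0`).
-/
def IsSubGaussianRel {Ω : Type*} [MeasurableSpace Ω] (X : Ω → ℝ) (ρ : ℝ) (μ : Measure Ω) : Prop :=
  ∃ B : ℝ, B = ρ * √(∫ ω, X ω ^ 2 ∂μ) ∧ IsSubGaussian X B μ

/-- A distribution on `ℝ^d` is independently sub-Gaussian with relative moment `ρ`: in some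
orthonormal basis, its coordinates are independent and sub-Gaussian with relative moment `ρ`. -/
def IsIndepSubGaussian {d : ℕ} (D : Measure (EuclideanSpace ℝ (Fin d))) (ρ : ℝ) : Prop :=
  ∃ a : OrthonormalBasis (Fin d) ℝ (EuclideanSpace ℝ (Fin d)),
    iIndepFun (fun i x => inner ℝ x (a i)) D ∧
      ∀ i, IsSubGaussianRel (fun x => inner ℝ x (a i)) ρ D

/-- The covariance matrix of a distribution on `ℝ^d`. -/
def covMatrix {d : ℕ} (D : Measure (EuclideanSpace ℝ (Fin d))) : Matrix (Fin d) (Fin d) ℝ :=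
  Matrix.of fun i j => covariance (fun x => x i) (fun x => x j) D

/-- The `m × d` matrix whose rows are the sample points `x 0, …, x (m - 1)`. -/
def sampleMatrix {m d : ℕ} (x : Fin m → EuclideanSpace ℝ (Fin d)) : Matrix (Fin m) (Fin d) ℝ :=
  Matrix.of fun i j => x i j

/-- The Gram matrix `X Xᵀ` of a sample. -/
def gramMatrix {m d : ℕ} (x : Fin m → EuclideanSpace ℝ (Fin d)) : Matrix (Fin m) (Fin m) ℝ :=
  sampleMatrix x * (sampleMatrix x).transpose

theorem gramMatrix_isHermitian {m d : ℕ} (x : Fin m → EuclideanSpace ℝ (Fin d)) :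
    (gramMatrix x).IsHermitian := by
  have h := Matrix.isHermitian_mul_conjTranspose_self (sampleMatrix x)
  rwa [Matrix.conjTranspose_eq_transpose_of_trivial] at h

/-- The `k`-th largest eigenvalue (with multiplicity, `1 ≤ k ≤ n`) of a real symmetric `n × n`
matrix. Mathlib's `eigenvalues₀` lists the eigenvalues in decreasing order, starting from
index `0`. -/
def kthLargestEigenvalue {n : ℕ} {A : Matrix (Fin n) (Fin n) ℝ} (hA : A.IsHermitian) (k : ℕ)
    (hk : 1 ≤ k ∧ k ≤ n) : ℝ :=
  hA.eigenvalues₀ ⟨k - 1, by rw [Fintype.card_fin]; omega⟩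

end

/-! All `m` eigenvalues of `X Xᵀ` are at least `m` as soon as `‖Xᵀ w‖² ≥ m` for every unit vector
`w`. Write `L = tr Σ`. For a fixed `w`, the coordinates of `Xᵀ w` in the basis `a` are again
independent, with the same variance proxies and second moments `v j ≤ 1` as one draw, and `∑ j, v j
= L`. Their squares are sub-exponential, so a Chernoff bound puts `‖Xᵀ w‖²` strictly between `L/2`
and `2L` except with probability `2 exp (-cL)`, where `c` depends only on `ρ`
(`measureReal_norm_sampleMap_tails`).

To treat all `w` at once, take a `1/4`-net of the sphere with at most `9^m` points
(`exists_sphere_net`). The union bound costs a factor `9^m`, which `m ≤ β L` makes harmless. Control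
on the net then gives `‖Xᵀ w‖² ≥ L/18 ≥ m` on the whole sphere (`le_norm_sq_of_net`). The upper tail
is needed too: it bounds the operator norm, hence the error in passing from the net to the sphere.
-/

/-! ### Exponential moments and tails of sums of squares -/

theorem exp_le_one_add_add_sq_mul_exp (u : ℝ) :
    Real.exp u ≤ 1 + u + u ^ 2 * Real.exp |u| := by
  have h := Complex.norm_exp_sub_sum_le_norm_mul_exp (u : ℂ) 2
  have h2 : Complex.exp u - ∑ m ∈ Finset.range 2, (u : ℂ) ^ m / m.factorial
      = ((Real.exp u - (1 + u) : ℝ) : ℂ) := by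
    simp [Finset.sum_range_succ]
  rw [h2, Complex.norm_real, Complex.norm_real, Real.norm_eq_abs, Real.norm_eq_abs, sq_abs] at h
  have := le_abs_self (Real.exp u - (1 + u))
  linarith

/-- For `|s| ≤ t`, the exponential `exp (s y)` of a nonnegative `y` exceeds `1 + s y` by a quadratic
error in `s / t`. -/
theorem exp_mul_le_one_add_add {s t y : ℝ} (ht : 0 < t) (hst : |s| ≤ t) (hy : 0 ≤ y) :
    Real.exp (s * y) ≤ 1 + s * y + 2 * (s / t) ^ 2 * Real.exp (2 * t * y) := by
  have h1 := exp_le_one_add_add_sq_mul_exp (s * y)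
  have hty : 0 ≤ t * y := by positivity
  have h2 : |s * y| ≤ t * y := by
    rw [abs_mul, abs_of_nonneg hy]; exact mul_le_mul_of_nonneg_right hst hy
  have h3 : (t * y) ^ 2 ≤ 2 * Real.exp (t * y) := by
    have := Real.quadratic_le_exp_of_nonneg hty
    nlinarith
  have h4 : (s * y) ^ 2 = (s / t) ^ 2 * (t * y) ^ 2 := by field_simp
  have h5 : Real.exp (2 * t * y) = Real.exp (t * y) * Real.exp (t * y) := by
    rw [← Real.exp_add]; ring_nf
  calc Real.exp (s * y) ≤ 1 + s * y + (s * y) ^ 2 * Real.exp |s * y| := h1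
    _ ≤ 1 + s * y + ((s / t) ^ 2 * (2 * Real.exp (t * y))) * Real.exp (t * y) := by
        rw [h4]; gcongr
    _ = _ := by rw [h5]; ring

theorem lintegral_exp_sq_div_four_gaussianReal :
    ∫⁻ g, ENNReal.ofReal (Real.exp (g ^ 2 / 4)) ∂(gaussianReal 0 1) ≤ 2 := by
  rw [gaussianReal_of_var_ne_zero _ one_ne_zero,
    lintegral_withDensity_eq_lintegral_mul _ (measurable_gaussianPDF _ _) (by fun_prop)]
  have h : ∀ g : ℝ, (gaussianPDF 0 1 * fun g ↦ ENNReal.ofReal (Real.exp (g ^ 2 / 4))) g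
      = ENNReal.ofReal ((√(2 * Real.pi))⁻¹ * Real.exp (-(1 / 4) * g ^ 2)) := by
    intro g
    simp only [Pi.mul_apply, gaussianPDF, gaussianPDFReal]
    rw [← ENNReal.ofReal_mul (by positivity), mul_assoc, ← Real.exp_add]
    congr 2
    · simp
    · congr 1
      simp
      ring
  simp_rw [h]
  rw [← ofReal_integral_eq_lintegral_ofReal
    ((integrable_exp_neg_mul_sq (by norm_num)).const_mul _)
    (Filter.Eventually.of_forall fun _ => by positivity), integral_const_mul, integral_gaussian]
  rw [show (2 : ENNReal) = ENNReal.ofReal 2 by simp]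
  apply ENNReal.ofReal_le_ofReal
  rw [inv_mul_le_iff₀ (by positivity)]
  apply Real.sqrt_le_iff.2 ⟨by positivity, ?_⟩
  rw [mul_pow, Real.sq_sqrt (by positivity)]
  nlinarith [Real.pi_pos]

section

variable {Ω : Type*} [MeasurableSpace Ω] {μ : Measure Ω} [IsProbabilityMeasure μ]

/-- A Gaussian `g` linearises the square: `exp (t y²) = 𝔼 exp (√(2t) y g)`. After Tonelli, the
sub-Gaussian bound leaves `𝔼 exp (c t g²)`, and `c t ≤ 1/4` reduces this to the Gaussian integral
above. -/
theorem lintegral_exp_mul_sq_le {Y : Ω → ℝ} {c : NNReal} (hY : HasSubgaussianMGF Y c μ)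
    (hm : Measurable Y) {t : ℝ} (ht : 0 ≤ t) (htc : c * t ≤ 1 / 4) :
    ∫⁻ ω, ENNReal.ofReal (Real.exp (t * Y ω ^ 2)) ∂μ ≤ 2 := by
  have h1 : ∀ y : ℝ, ENNReal.ofReal (Real.exp (t * y ^ 2))
      = ∫⁻ g, ENNReal.ofReal (Real.exp (√(2 * t) * y * g)) ∂(gaussianReal 0 1) := by
    intro y
    rw [← ofReal_integral_eq_lintegral_ofReal (integrable_exp_mul_gaussianReal _)
      (Filter.Eventually.of_forall fun _ => by positivity)]
    have := mgf_gaussianReal (p := gaussianReal 0 1) (X := id) (μ := 0) (v := 1) (by simp)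
      (√(2 * t) * y)
    simp only [mgf, id] at this
    rw [this, mul_pow, Real.sq_sqrt (by positivity)]
    congr 2
    simp
    ring
  simp_rw [h1]
  rw [lintegral_lintegral_swap (by fun_prop)]
  refine le_trans (lintegral_mono fun g => ?_) lintegral_exp_sq_div_four_gaussianReal
  have h2 : ∀ ω, √(2 * t) * Y ω * g = (√(2 * t) * g) * Y ω := fun ω => by ring
  simp_rw [h2]
  rw [← ofReal_integral_eq_lintegral_ofReal (hY.integrable_exp_mul _)
      (Filter.Eventually.of_forall fun _ => by positivity)]
  apply ENNReal.ofReal_le_ofReal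
  refine (hY.mgf_le _).trans (Real.exp_le_exp.2 ?_)
  rw [mul_pow, Real.sq_sqrt (by positivity)]
  nlinarith [mul_le_mul_of_nonneg_right htc (sq_nonneg g)]

theorem integral_exp_mul_sq_le {Y : Ω → ℝ} {c : NNReal} (hY : HasSubgaussianMGF Y c μ)
    (hm : Measurable Y) {t : ℝ} (ht : 0 ≤ t) (htc : c * t ≤ 1 / 4) :
    Integrable (fun ω => Real.exp (t * Y ω ^ 2)) μ ∧ ∫ ω, Real.exp (t * Y ω ^ 2) ∂μ ≤ 2 := by
  have h := lintegral_exp_mul_sq_le hY hm ht htc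
  have hi : Integrable (fun ω => Real.exp (t * Y ω ^ 2)) μ := by
    refine ⟨by fun_prop, ?_⟩
    rw [hasFiniteIntegral_iff_ofReal (Filter.Eventually.of_forall fun _ => by positivity)]
    exact h.trans_lt (by simp)
  refine ⟨hi, ?_⟩
  rw [← ofReal_integral_eq_lintegral_ofReal hi
      (Filter.Eventually.of_forall fun _ => by positivity)] at h
  exact (ENNReal.ofReal_le_ofReal_iff (by norm_num)).1 (by simpa using h)

/-- The square of a sub-Gaussian variable is sub-exponential. -/
theorem mgf_sq_le {Y : Ω → ℝ} {ρ v : ℝ} (hρ : 0 < ρ) (hv0 : 0 ≤ v) (hv1 : v ≤ 1)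
    (hY : HasSubgaussianMGF Y (ρ ^ 2 * v).toNNReal μ) (hm : Measurable Y)
    (hv : ∫ ω, Y ω ^ 2 ∂μ = v) {s : ℝ} (hs : |s| ≤ 1 / (8 * ρ ^ 2)) :
    Integrable (fun ω => Real.exp (s * Y ω ^ 2)) μ ∧
      mgf (fun ω => Y ω ^ 2) μ s ≤ Real.exp (s * v + 256 * ρ ^ 4 * s ^ 2 * v) := by
  rcases hv0.eq_or_lt with h0 | hpos
  · subst h0
    have hY0 : Y =ᵐ[μ] 0 := by
      apply HasSubgaussianMGF.ae_eq_zero_of_hasSubgaussianMGF_zero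
      simpa using hY
    have h1 : (fun ω => Real.exp (s * Y ω ^ 2)) =ᵐ[μ] fun _ => 1 := by
      filter_upwards [hY0] with ω h
      simp [h]
    refine ⟨(integrable_congr h1).2 (integrable_const _), ?_⟩
    rw [mgf, integral_congr_ae h1]
    simp
  -- Chosen so that `ρ² v · 2t = 1/4`, the limit allowed in `integral_exp_mul_sq_le`; `v ≤ 1` gives
  -- `|s| ≤ t`.
  · set t : ℝ := 1 / (8 * ρ ^ 2 * v) with ht
    have htpos : 0 < t := by positivity
    have hst : |s| ≤ t := by
      refine hs.trans ?_
      rw [ht]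
      apply one_div_le_one_div_of_le (by positivity)
      exact mul_le_of_le_one_right (by positivity) hv1
    obtain ⟨hi, hle⟩ := integral_exp_mul_sq_le hY hm (t := 2 * t) (by positivity) (by
      rw [Real.coe_toNNReal _ (by positivity), ht]
      apply le_of_eq
      field_simp
      norm_num)
    have hpt : ∀ ω, Real.exp (s * Y ω ^ 2)
        ≤ 1 + s * Y ω ^ 2 + 2 * (s / t) ^ 2 * Real.exp (2 * t * Y ω ^ 2) :=
      fun ω => exp_mul_le_one_add_add htpos hst (sq_nonneg _)
    have hisq : Integrable (fun ω => Y ω ^ 2) μ := (hY.memLp 2).integrable_sq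
    have hi1 : Integrable (fun ω => 1 + s * Y ω ^ 2) μ :=
      (integrable_const _).add (hisq.const_mul s)
    have hi2 : Integrable (fun ω => 2 * (s / t) ^ 2 * Real.exp (2 * t * Y ω ^ 2)) μ :=
      hi.const_mul _
    have hirhs := hi1.add hi2
    have hint : Integrable (fun ω => Real.exp (s * Y ω ^ 2)) μ := by
      refine hirhs.mono' (by fun_prop) (Filter.Eventually.of_forall fun ω => ?_)
      rw [Real.norm_of_nonneg (by positivity)]
      exact hpt ω
    refine ⟨hint, ?_⟩
    calc mgf (fun ω => Y ω ^ 2) μ s ≤ ∫ ω, (1 + s * Y ω ^ 2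
            + 2 * (s / t) ^ 2 * Real.exp (2 * t * Y ω ^ 2)) ∂μ :=
          integral_mono hint hirhs hpt
      _ = 1 + s * v + 2 * (s / t) ^ 2 * ∫ ω, Real.exp (2 * t * Y ω ^ 2) ∂μ := by
          rw [integral_add hi1 hi2, integral_add (integrable_const _) (hisq.const_mul s),
            integral_const_mul, integral_const_mul, hv]
          simp
      _ ≤ 1 + s * v + 2 * (s / t) ^ 2 * 2 := by gcongr
      _ = 1 + s * v + 256 * ρ ^ 4 * s ^ 2 * v ^ 2 := by rw [ht]; field_simp; ring
      -- Using `v² ≤ v` makes the error linear in `v`, so that it sums to a multiple of the trace.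
      _ ≤ 1 + s * v + 256 * ρ ^ 4 * s ^ 2 * v := by
          gcongr
          nlinarith
      _ ≤ _ := by
          have := Real.add_one_le_exp (s * v + 256 * ρ ^ 4 * s ^ 2 * v)
          linarith

/-- The rate in the tail bounds for sums of squares of sub-Gaussian variables with relative
moment `ρ`. -/
noncomputable def tailRate (ρ : ℝ) : ℝ := min (1 / (8 * ρ ^ 2)) (1 / (1024 * ρ ^ 4)) / 4

theorem tailRate_pos {ρ : ℝ} (hρ : 0 < ρ) : 0 < tailRate ρ := by
  unfold tailRate; positivity

theorem mgf_sum_sq_le {ι : Type*} [Fintype ι] {Y : ι → Ω → ℝ} {v : ι → ℝ} {ρ : ℝ} (hρ : 0 < ρ)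
    (hind : iIndepFun Y μ) (hm : ∀ j, Measurable (Y j))
    (hv0 : ∀ j, 0 ≤ v j) (hv1 : ∀ j, v j ≤ 1)
    (hY : ∀ j, HasSubgaussianMGF (Y j) (ρ ^ 2 * v j).toNNReal μ)
    (hv : ∀ j, ∫ ω, Y j ω ^ 2 ∂μ = v j) {s : ℝ} (hs : |s| ≤ 1 / (8 * ρ ^ 2)) :
    Integrable (fun ω => Real.exp (s * ∑ j, Y j ω ^ 2)) μ ∧
      mgf (fun ω => ∑ j, Y j ω ^ 2) μ s
        ≤ Real.exp (s * (∑ j, v j) + 256 * ρ ^ 4 * s ^ 2 * ∑ j, v j) := by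
  have hind2 : iIndepFun (fun j ω => Y j ω ^ 2) μ :=
    hind.comp (fun _ y => y ^ 2) (fun _ => by fun_prop)
  have hsum : (fun ω => ∑ j, Y j ω ^ 2) = ∑ j, fun ω => Y j ω ^ 2 := by
    ext; simp
  have h := fun j => mgf_sq_le hρ (hv0 j) (hv1 j) (hY j) (hm j) (hv j) hs
  constructor
  · have := hind2.integrable_exp_mul_sum (t := s) (s := Finset.univ) (fun j => by fun_prop)
      (fun j _ => (h j).1)
    simpa using this
  · rw [hsum, hind2.mgf_sum (fun j => by fun_prop), Finset.mul_sum, Finset.mul_sum,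
      ← Finset.sum_add_distrib, Real.exp_sum]
    exact Finset.prod_le_prod (fun _ _ => mgf_nonneg) fun j _ => (h j).2

/-- Chernoff at `±s`, with `s` small enough that the quadratic error is at most `sL/4`. The lower
tail is the binding one: its exponent is `sL/2 - sL + sL/4 = -sL/4`. -/
theorem measureReal_sum_sq_tails {ι : Type*} [Fintype ι] {Y : ι → Ω → ℝ} {v : ι → ℝ} {ρ : ℝ}
    (hρ : 0 < ρ) (hind : iIndepFun Y μ) (hm : ∀ j, Measurable (Y j))
    (hv0 : ∀ j, 0 ≤ v j) (hv1 : ∀ j, v j ≤ 1)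
    (hY : ∀ j, HasSubgaussianMGF (Y j) (ρ ^ 2 * v j).toNNReal μ)
    (hv : ∀ j, ∫ ω, Y j ω ^ 2 ∂μ = v j) :
    μ.real {ω | 2 * ∑ j, v j ≤ ∑ j, Y j ω ^ 2} ≤ Real.exp (-(tailRate ρ * ∑ j, v j)) ∧
      μ.real {ω | ∑ j, Y j ω ^ 2 ≤ (∑ j, v j) / 2} ≤ Real.exp (-(tailRate ρ * ∑ j, v j)) := by
  set L := ∑ j, v j with hL
  have hL0 : 0 ≤ L := Finset.sum_nonneg fun j _ => hv0 j
  set s := min (1 / (8 * ρ ^ 2)) (1 / (1024 * ρ ^ 4)) with hs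
  have hs0 : 0 < s := by rw [hs]; positivity
  have hs1 : s ≤ 1 / (8 * ρ ^ 2) := min_le_left _ _
  have hs2 : 256 * ρ ^ 4 * s ≤ 1 / 4 := by
    calc 256 * ρ ^ 4 * s ≤ 256 * ρ ^ 4 * (1 / (1024 * ρ ^ 4)) := by gcongr; exact min_le_right _ _
      _ = 1 / 4 := by field_simp; norm_num
  have hquad : 256 * ρ ^ 4 * s ^ 2 * L ≤ s / 4 * L := by
    have := mul_le_mul_of_nonneg_right hs2 (mul_nonneg hs0.le hL0)
    linarith
  have hsL : 0 ≤ s * L := by positivity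
  have hrate : tailRate ρ = s / 4 := rfl
  rw [hrate]
  constructor
  · obtain ⟨h1, h2⟩ := mgf_sum_sq_le hρ hind hm hv0 hv1 hY hv (s := s)
      (by rwa [abs_of_pos hs0])
    refine (measure_ge_le_exp_mul_mgf (2 * L) hs0.le h1).trans
      ((mul_le_mul_of_nonneg_left h2 (Real.exp_nonneg _)).trans ?_)
    rw [← Real.exp_add, Real.exp_le_exp]
    linarith
  · obtain ⟨h1, h2⟩ := mgf_sum_sq_le hρ hind hm hv0 hv1 hY hv (s := -s)
      (by rwa [abs_neg, abs_of_pos hs0])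
    refine (measure_le_le_exp_mul_mgf (L / 2) (neg_nonpos.2 hs0.le) h1).trans
      ((mul_le_mul_of_nonneg_left h2 (Real.exp_nonneg _)).trans ?_)
    rw [← Real.exp_add, Real.exp_le_exp]
    rw [neg_sq]
    linarith

end

/-! ### Regrouping independent arrays -/

/-- Grouping a doubly indexed independent family into blocks. -/
theorem ProbabilityTheory.iIndepFun_curry {Ω ι κ 𝓧 : Type*} [MeasurableSpace Ω] [MeasurableSpace 𝓧]
    {P : Measure Ω} {X : ι → κ → Ω → 𝓧} (mX : ∀ i j, Measurable (X i j))
    (h : iIndepFun (fun (p : ι × κ) ω => X p.1 p.2 ω) P) :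
    iIndepFun (fun i ω j => X i j ω) P := by
  have := h.isProbabilityMeasure
  have : ∀ i j, IsProbabilityMeasure (P.map (X i j)) :=
    fun i j => Measure.isProbabilityMeasure_map (mX i j).aemeasurable
  rw [iIndepFun_iff_map_fun_eq_infinitePi_map (by fun_prop)]
  have h1 := (iIndepFun_iff_map_fun_eq_infinitePi_map (by fun_prop)).1 h
  have h2 : ∀ i, P.map (fun ω j => X i j ω) = Measure.infinitePi fun j => P.map (X i j) :=
    fun i => (iIndepFun_iff_map_fun_eq_infinitePi_map (by fun_prop)).1
      (h.precomp (g := fun j => (i, j)) fun a b hab => (Prod.ext_iff.1 hab).2)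
  simp_rw [h2]
  rw [← Measure.infinitePi_map_curry, ← h1, Measure.map_map (by fun_prop) (by fun_prop)]
  rfl

/-! ### Nets of the unit sphere -/

section Net

open Metric Module

/-- Volume packing: the balls of radius `1/8` about the points are disjoint and lie in the ball of
radius `9/8`. -/
theorem card_le_of_quarter_separated {E : Type*} [NormedAddCommGroup E] [NormedSpace ℝ E]
    [FiniteDimensional ℝ E] (s : Finset E) (hs : ∀ c ∈ s, ‖c‖ ≤ 1)
    (h : ∀ c ∈ s, ∀ d ∈ s, c ≠ d → 1 / 4 ≤ ‖c - d‖) : s.card ≤ 9 ^ finrank ℝ E := by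
  borelize E
  let μ : Measure E := Measure.addHaar
  have hdisj : Set.Pairwise (s : Set E) (Function.onFun Disjoint fun c => ball (c : E) (1 / 8)) := by
    rintro c hc d hd hcd
    apply ball_disjoint_ball
    rw [dist_eq_norm]
    have := h c hc d hd hcd
    linarith
  have hsub : ⋃ c ∈ s, ball (c : E) (1 / 8) ⊆ ball (0 : E) (9 / 8) := by
    refine Set.iUnion₂_subset fun x hx => ball_subset_ball' ?_
    rw [dist_zero_right]
    linarith [hs x hx]
  have hvol : (s.card : ENNReal) * ENNReal.ofReal ((1 / 8 : ℝ) ^ finrank ℝ E) * μ (ball 0 1) ≤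
      ENNReal.ofReal ((9 / 8 : ℝ) ^ finrank ℝ E) * μ (ball 0 1) :=
    calc
      _ = μ (⋃ c ∈ s, ball (c : E) (1 / 8)) := by
        rw [measure_biUnion_finset hdisj fun c _ => measurableSet_ball]
        simp only [μ.addHaar_ball_of_pos _ (show (0 : ℝ) < 1 / 8 by norm_num)]
        simp only [Finset.sum_const, nsmul_eq_mul, mul_assoc]
      _ ≤ μ (ball (0 : E) (9 / 8)) := measure_mono hsub
      _ = _ := by simp only [μ.addHaar_ball_of_pos _ (show (0 : ℝ) < 9 / 8 by norm_num)]
  have hcard : (s.card : ENNReal) * ENNReal.ofReal ((1 / 8 : ℝ) ^ finrank ℝ E) ≤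
      ENNReal.ofReal ((9 / 8 : ℝ) ^ finrank ℝ E) :=
    (ENNReal.mul_le_mul_iff_left (measure_ball_pos _ _ zero_lt_one).ne' measure_ball_lt_top.ne).1
      hvol
  have hreal : (s.card : ℝ) ≤ (9 : ℝ) ^ finrank ℝ E := by
    have := ENNReal.toReal_le_of_le_ofReal (by positivity) hcard
    simpa [div_eq_mul_inv, mul_pow] using this
  exact mod_cast hreal

theorem exists_sphere_net (E : Type*) [NormedAddCommGroup E] [NormedSpace ℝ E]
    [FiniteDimensional ℝ E] :
    ∃ N : Finset E, N.card ≤ 9 ^ finrank ℝ E ∧ (∀ v ∈ N, ‖v‖ = 1) ∧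
      ∀ w : E, ‖w‖ = 1 → ∃ v ∈ N, ‖w - v‖ ≤ 1 / 4 := by
  classical
  let P : Finset E → Prop := fun s =>
    (∀ c ∈ s, ‖c‖ = 1) ∧ ∀ c ∈ s, ∀ d ∈ s, c ≠ d → 1 / 4 ≤ ‖c - d‖
  have hP : ∀ s, P s → s.card ≤ 9 ^ finrank ℝ E := fun s hs =>
    card_le_of_quarter_separated s (fun c hc => (hs.1 c hc).le) hs.2
  let S : Set ℕ := {n | ∃ s, P s ∧ s.card = n}
  have hbdd : BddAbove S := ⟨9 ^ finrank ℝ E, by rintro n ⟨s, hs, rfl⟩; exact hP s hs⟩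
  -- A separated set of maximal cardinality is a net, since an uncovered unit vector could be added
  -- to it.
  obtain ⟨N, hN, hcard⟩ := Nat.sSup_mem (s := S) ⟨0, ∅, by simp [P], rfl⟩ hbdd
  refine ⟨N, hP N hN, hN.1, fun w hw => ?_⟩
  by_contra! hcon
  have hwN : w ∉ N := fun h => by
    have := hcon w h
    simp at this
    linarith
  have hins : P (insert w N) := by
    refine ⟨fun c hc => ?_, fun c hc d hd hcd => ?_⟩
    · rcases Finset.mem_insert.1 hc with rfl | hc
      · exact hw
      · exact hN.1 c hc
    · rcases Finset.mem_insert.1 hc with hc' | hc' <;>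
        rcases Finset.mem_insert.1 hd with hd' | hd'
      · exact absurd (hc'.trans hd'.symm) hcd
      · rw [hc']; exact (hcon d hd').le
      · rw [hd', norm_sub_rev]; exact (hcon c hc').le
      · exact hN.2 c hc' d hd' hcd
  have := le_csSup hbdd ⟨insert w N, hins, rfl⟩
  rw [Finset.card_insert_of_notMem hwN] at this
  omega

/-- Two-sided control of `‖T v‖²` on a net of the unit sphere bounds `T` from below on the whole
sphere. -/
theorem le_norm_sq_of_net {E F : Type*} [NormedAddCommGroup E] [NormedSpace ℝ E]
    [NormedAddCommGroup F] [NormedSpace ℝ F] (T : E →L[ℝ] F) {N : Set E}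
    (hnet : ∀ w : E, ‖w‖ = 1 → ∃ v ∈ N, ‖w - v‖ ≤ 1 / 4)
    {L : ℝ} (hup : ∀ v ∈ N, ‖T v‖ ^ 2 ≤ 2 * L) (hlow : ∀ v ∈ N, L / 2 ≤ ‖T v‖ ^ 2)
    {w : E} (hw : ‖w‖ = 1) : L / 18 ≤ ‖T w‖ ^ 2 := by
  obtain ⟨v, hv, hwv⟩ := hnet w hw
  have hL : 0 ≤ L := by have := (sq_nonneg ‖T v‖).trans (hup v hv); linarith
  set r := √(L / 2) with hr
  have hr0 : 0 ≤ r := Real.sqrt_nonneg _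
  have hr2 : r ^ 2 = L / 2 := Real.sq_sqrt (by positivity)
  have hT : ∀ u u' : E, ‖u - u'‖ ≤ 1 / 4 → ‖T u - T u'‖ ≤ ‖T‖ / 4 := fun u u' h => by
    rw [← map_sub]
    exact (T.le_opNorm _).trans (by nlinarith [norm_nonneg T])
  -- Self-bounding: this gives `‖T‖ ≤ 8r/3`, so moving from `v` to `w` costs at most `2r/3` out of
  -- `r`.
  have hop : ‖T‖ ≤ 2 * r + ‖T‖ / 4 := by
    refine T.opNorm_le_of_unit_norm (by positivity) fun u hu => ?_
    obtain ⟨u', hu', huu'⟩ := hnet u hu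
    have h1 : ‖T u'‖ ≤ 2 * r := abs_le_of_sq_le_sq' (by nlinarith [hup u' hu']) (by positivity) |>.2
    have h2 := hT u u' huu'
    have h3 := norm_sub_norm_le (T u) (T u')
    linarith
  have h1 : r ≤ ‖T v‖ :=
    abs_le_of_sq_le_sq' (by nlinarith [hlow v hv]) (norm_nonneg _) |>.2
  have h2 := hT w v hwv
  have h3 := norm_sub_norm_le (T v) (T w)
  rw [norm_sub_rev] at h3
  have h4 : r / 3 ≤ ‖T w‖ := by linarith
  calc L / 18 = (r / 3) ^ 2 := by rw [div_pow, hr2]; ring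
    _ ≤ _ := by gcongr

end Net

/-! ### Gram matrix eigenvalues -/

/-- The linear map `w ↦ Xᵀ w` attached to the sample matrix `X`. -/
noncomputable def sampleMap {m d : ℕ} (x : Fin m → EuclideanSpace ℝ (Fin d)) :
    EuclideanSpace ℝ (Fin m) →L[ℝ] EuclideanSpace ℝ (Fin d) :=
  LinearMap.toContinuousLinearMap
    ((Fintype.linearCombination ℝ x) ∘ₗ (WithLp.linearEquiv 2 ℝ (Fin m → ℝ)).toLinearMap)

theorem sampleMap_apply {m d : ℕ} (x : Fin m → EuclideanSpace ℝ (Fin d))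
    (w : EuclideanSpace ℝ (Fin m)) : sampleMap x w = ∑ i, w i • x i := by
  simp [sampleMap, Fintype.linearCombination_apply]

theorem dotProduct_gramMatrix_mulVec {m d : ℕ} (x : Fin m → EuclideanSpace ℝ (Fin d))
    (w : EuclideanSpace ℝ (Fin m)) :
    dotProduct w.ofLp ((gramMatrix x).mulVec w.ofLp) = ‖sampleMap x w‖ ^ 2 := by
  have h : (sampleMatrix x).transpose.mulVec w.ofLp = (sampleMap x w).ofLp := by
    ext j
    simp [sampleMap_apply, sampleMatrix, Matrix.mulVec, dotProduct, mul_comm]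
  rw [gramMatrix, ← Matrix.mulVec_mulVec, Matrix.dotProduct_mulVec, ← Matrix.mulVec_transpose, h,
    EuclideanSpace.real_norm_sq_eq]
  simp [dotProduct, sq]

/-- Each eigenvalue is the value of the quadratic form `‖Xᵀ w‖²` at a unit eigenvector, so no
min-max principle is needed. -/
theorem le_kthLargestEigenvalue_gramMatrix {m d k : ℕ} (x : Fin m → EuclideanSpace ℝ (Fin d))
    (hk : 1 ≤ k ∧ k ≤ m) {c : ℝ}
    (h : ∀ w : EuclideanSpace ℝ (Fin m), ‖w‖ = 1 → c ≤ ‖sampleMap x w‖ ^ 2) :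
    c ≤ kthLargestEigenvalue (gramMatrix_isHermitian x) k hk := by
  have hA := gramMatrix_isHermitian x
  obtain ⟨i, hi⟩ : ∃ i, hA.eigenvalues i
      = kthLargestEigenvalue (gramMatrix_isHermitian x) k hk :=
    ⟨Fintype.equivOfCardEq (Fintype.card_fin _) ⟨k - 1, by rw [Fintype.card_fin]; omega⟩, by
      simp [Matrix.IsHermitian.eigenvalues, kthLargestEigenvalue]⟩
  rw [← hi, hA.eigenvalues_eq]
  have := h (hA.eigenvectorBasis i) (hA.eigenvectorBasis.orthonormal.1 i)
  rw [← dotProduct_gramMatrix_mulVec] at this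
  simpa using this

/-! ### Centring and covariance -/

/-- `1 + t 𝔼X ≤ 𝔼 exp (tX) ≤ exp (c t²/2)` is an equality at `t = 0`, so the derivatives of the two
ends agree there. Centring identifies variances with second moments. -/
theorem ProbabilityTheory.HasSubgaussianMGF.integral_eq_zero {Ω : Type*} [MeasurableSpace Ω] {μ : Measure Ω}
    [IsProbabilityMeasure μ] {X : Ω → ℝ} {c : NNReal} (h : HasSubgaussianMGF X c μ) :
    ∫ ω, X ω ∂μ = 0 := by
  set a := ∫ ω, X ω ∂μ with ha
  have key : ∀ t : ℝ, 1 + t * a ≤ Real.exp (c * t ^ 2 / 2) := fun t => by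
    have h1 : ∫ ω, (1 + t * X ω) ∂μ = 1 + t * a := by
      rw [integral_add (integrable_const _) (h.integrable.const_mul t), integral_const_mul]
      simp [ha]
    rw [← h1]
    refine le_trans (integral_mono ((integrable_const _).add (h.integrable.const_mul t))
      (h.integrable_exp_mul t) fun ω => ?_) (h.mgf_le t)
    have := Real.add_one_le_exp (t * X ω)
    simp only
    linarith
  have hder : HasDerivAt (fun t : ℝ => Real.exp (c * t ^ 2 / 2) - (1 + t * a)) (-a) 0 := by
    have h1 : HasDerivAt (fun t : ℝ => (c : ℝ) * t ^ 2 / 2) 0 0 := by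
      simpa using (((hasDerivAt_id (0 : ℝ)).pow 2).const_mul (c : ℝ)).div_const 2
    have h2 := (h1.exp).sub (((hasDerivAt_id (0 : ℝ)).mul_const a).const_add 1)
    have h3 : (0 : ℝ) - 1 * a = -a := by ring
    simp only [mul_zero, h3] at h2
    exact h2
  have hmin : IsLocalMin (fun t : ℝ => Real.exp (c * t ^ 2 / 2) - (1 + t * a)) 0 :=
    Filter.Eventually.of_forall fun t => by
      have := key t
      simp
      linarith
  have := hmin.hasDerivAt_eq_zero hder
  linarith

section Covariance

variable {d : ℕ} {D : Measure (EuclideanSpace ℝ (Fin d))} 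

theorem variance_inner_le_one [IsProbabilityMeasure D] (hcov : (1 - covMatrix D).PosSemidef)
    (hX : ∀ i, MemLp (fun x : EuclideanSpace ℝ (Fin d) => x i) 2 D)
    {u : EuclideanSpace ℝ (Fin d)} (hu : ‖u‖ = 1) :
    variance (fun x => inner ℝ x u) D ≤ 1 := by
  have h1 : variance (fun x => inner ℝ x u) D
      = dotProduct u.ofLp ((covMatrix D).mulVec u.ofLp) := by
    have hin : (fun x : EuclideanSpace ℝ (Fin d) => inner ℝ x u) = fun x => ∑ i, u i * x i := by
      ext x
      simp [PiLp.inner_apply]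
    rw [hin, variance_fun_sum fun i => (hX i).const_mul (u i)]
    simp only [covariance_const_mul_left, covariance_const_mul_right, dotProduct, Matrix.mulVec,
      covMatrix, Matrix.of_apply, Finset.mul_sum]
    exact Finset.sum_congr rfl fun i _ => Finset.sum_congr rfl fun j _ => by ring
  have h2 := hcov.re_dotProduct_nonneg u.ofLp
  rw [Matrix.sub_mulVec, Matrix.one_mulVec, dotProduct_sub] at h2
  have h3 : dotProduct u.ofLp u.ofLp = 1 := by
    have := EuclideanSpace.real_norm_sq_eq u
    rw [hu] at this
    simp only [dotProduct, ← sq]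
    linarith
  simp at h2
  linarith

/-- Both sides are `𝔼‖x‖²`, expanded in two orthonormal bases. -/
theorem trace_covMatrix (a : OrthonormalBasis (Fin d) ℝ (EuclideanSpace ℝ (Fin d)))
    (hX : ∀ i, MemLp (fun x : EuclideanSpace ℝ (Fin d) => x i) 2 D)
    (hX0 : ∀ i, ∫ x, x i ∂D = 0) (ha : ∀ j, MemLp (fun x => inner ℝ x (a j)) 2 D) :
    (covMatrix D).trace = ∑ j, ∫ x, (inner ℝ x (a j)) ^ 2 ∂D := by
  have h1 : (covMatrix D).trace = ∑ i, ∫ x, x i ^ 2 ∂D := by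
    simp only [Matrix.trace, Matrix.diag, covMatrix, Matrix.of_apply]
    refine Finset.sum_congr rfl fun i _ => ?_
    rw [covariance_self (hX i).aemeasurable,
      variance_of_integral_eq_zero (hX i).aemeasurable (hX0 i)]
  rw [h1, ← integral_finsetSum _ fun i _ => (hX i).integrable_sq,
    ← integral_finsetSum _ fun j _ => (ha j).integrable_sq]
  congr 1
  ext x
  rw [← EuclideanSpace.real_norm_sq_eq, ← a.sum_sq_norm_inner_left x]
  simp

end Covariance

/-! ### Weighted sums of independent draws -/

theorem ProbabilityTheory.iIndepFun.comp_measurePreserving {Ω Ω' ι : Type*} [MeasurableSpace Ω]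
    [MeasurableSpace Ω'] [Fintype ι] {P : Measure Ω} {Q : Measure Ω'} [IsProbabilityMeasure P]
    [IsProbabilityMeasure Q] {φ : Ω' → Ω} (hφ : MeasurePreserving φ Q P) {Z : ι → Ω → ℝ}
    (hZ : ∀ j, Measurable (Z j)) (h : iIndepFun Z P) : iIndepFun (fun j ω => Z j (φ ω)) Q := by
  have hφm := hφ.measurable
  rw [iIndepFun_iff_map_fun_eq_pi_map fun j => by fun_prop] at h ⊢
  rw [← hφ.map_eq] at h
  simp_rw [Measure.map_map (hZ _) hφm] at h
  rw [Measure.map_map (by fun_prop) hφm] at h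
  exact h

section Product

variable {E : Type*} [MeasurableSpace E] {D : Measure E} [IsProbabilityMeasure D] {m : ℕ}

theorem iIndepFun_weighted_sum {ι : Type*} [Fintype ι] {Z : ι → E → ℝ}
    (hZ : ∀ j, Measurable (Z j)) (h : iIndepFun Z D) (w : Fin m → ℝ) :
    iIndepFun (fun j (x : Fin m → E) => ∑ i, w i * Z j (x i)) (Measure.pi fun _ => D) := by
  have h1 : iIndepFun (fun i (x : Fin m → E) j => Z j (x i)) (Measure.pi fun _ => D) :=
    iIndepFun_pi (X := fun _ y j => Z j y) fun _ => Measurable.aemeasurable (by fun_prop)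
  -- Independence across draws and within each draw makes the whole array independent; it is then
  -- regrouped by coordinate.
  have h2 := iIndepFun_uncurry' (X := fun i j (x : Fin m → E) => Z j (x i)) (by fun_prop) h1
    fun i => iIndepFun.comp_measurePreserving (measurePreserving_eval (fun _ => D) i) hZ h
  have h3 := iIndepFun_curry (X := fun j i (x : Fin m → E) => Z j (x i)) (by fun_prop)
    (h2.precomp Prod.swap_injective)
  exact h3.comp (fun _ z => ∑ i, w i * z i) fun _ => by fun_prop

/-- Variance proxies add to `∑ i, w i ^ 2 * c = c`: unit weights lose nothing. -/
theorem hasSubgaussianMGF_weighted_sum {Z : E → ℝ} (hZ : Measurable Z) {c : NNReal}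
    (h : HasSubgaussianMGF Z c D) {w : Fin m → ℝ} (hw : ∑ i, w i ^ 2 = 1) :
    HasSubgaussianMGF (fun x : Fin m → E => ∑ i, w i * Z (x i)) c (Measure.pi fun _ => D) := by
  have hind : iIndepFun (fun i (x : Fin m → E) => w i * Z (x i)) (Measure.pi fun _ => D) :=
    iIndepFun_pi (X := fun i y => w i * Z y) fun _ => Measurable.aemeasurable (by fun_prop)
  have hsub : ∀ i ∈ Finset.univ, HasSubgaussianMGF (fun x : Fin m → E => w i * Z (x i))
      ((w i ^ 2).toNNReal * c) (Measure.pi fun _ => D) := fun i _ => by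
    rw [Real.toNNReal_of_nonneg (sq_nonneg _)]
    refine HasSubgaussianMGF.const_mul (X := fun x : Fin m → E => Z (x i)) ?_ (w i)
    refine HasSubgaussianMGF.of_map (X := Z) (Y := fun x : Fin m → E => x i)
      (measurable_pi_apply i).aemeasurable ?_
    rwa [(measurePreserving_eval (fun _ => D) i).map_eq]
  have := HasSubgaussianMGF.sum_of_iIndepFun hind hsub
  convert this using 1
  rw [← Finset.sum_mul, ← Real.toNNReal_sum_of_nonneg fun i _ => sq_nonneg _, hw]
  simp

theorem integral_weighted_sum_sq {Z : E → ℝ} (hZ : Measurable Z) {c : NNReal}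
    (h : HasSubgaussianMGF Z c D) {w : Fin m → ℝ} (hw : ∑ i, w i ^ 2 = 1) :
    ∫ x : Fin m → E, (∑ i, w i * Z (x i)) ^ 2 ∂(Measure.pi fun _ => D) = ∫ y, Z y ^ 2 ∂D := by
  have hs := hasSubgaussianMGF_weighted_sum hZ h hw
  have h1 := variance_of_integral_eq_zero hs.aemeasurable hs.integral_eq_zero
  have h2 := variance_of_integral_eq_zero h.aemeasurable h.integral_eq_zero
  have h3 := variance_sum_pi (μ := fun _ : Fin m => D) (X := fun i y => w i * Z y)
    fun i => (h.memLp 2).const_mul (w i)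
  simp only [variance_const_mul, ← Finset.sum_mul, hw, one_mul] at h3
  rw [← h1, ← h2, ← h3]
  congr 1
  ext x
  simp

end Product

/-! ### Concentration and the union bound -/

theorem measureReal_norm_sampleMap_tails {ρ : ℝ} (hρ : 0 < ρ) {d m : ℕ}
    {D : Measure (EuclideanSpace ℝ (Fin d))} [IsProbabilityMeasure D]
    {a : OrthonormalBasis (Fin d) ℝ (EuclideanSpace ℝ (Fin d))}
    (hind : iIndepFun (fun j x => inner ℝ x (a j)) D) {v : Fin d → ℝ}
    (hv : ∀ j, ∫ x, (inner ℝ x (a j)) ^ 2 ∂D = v j) (hv1 : ∀ j, v j ≤ 1)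
    (hsub : ∀ j, HasSubgaussianMGF (fun x => inner ℝ x (a j)) (ρ ^ 2 * v j).toNNReal D)
    {w : EuclideanSpace ℝ (Fin m)} (hw : ‖w‖ = 1) :
    (Measure.pi fun _ : Fin m => D).real {x | 2 * ∑ j, v j ≤ ‖sampleMap x w‖ ^ 2}
        ≤ Real.exp (-(tailRate ρ * ∑ j, v j)) ∧
      (Measure.pi fun _ : Fin m => D).real {x | ‖sampleMap x w‖ ^ 2 ≤ (∑ j, v j) / 2}
        ≤ Real.exp (-(tailRate ρ * ∑ j, v j)) := by
  have hw2 : ∑ i, w i ^ 2 = 1 := by rw [← EuclideanSpace.real_norm_sq_eq, hw, one_pow]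
  have hm : ∀ j, Measurable fun x : EuclideanSpace ℝ (Fin d) => inner ℝ x (a j) :=
    fun j => by fun_prop
  have hv0 : ∀ j, 0 ≤ v j := fun j => by
    rw [← hv j]; exact integral_nonneg fun _ => sq_nonneg _
  have hnorm : ∀ x : Fin m → EuclideanSpace ℝ (Fin d),
      ‖sampleMap x w‖ ^ 2 = ∑ j, (∑ i, w i * inner ℝ (x i) (a j)) ^ 2 := fun x => by
    rw [← a.sum_sq_norm_inner_left (sampleMap x w)]
    simp [sampleMap_apply, sum_inner, real_inner_smul_left]
  simp_rw [hnorm]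
  exact measureReal_sum_sq_tails hρ (iIndepFun_weighted_sum hm hind w.ofLp)
    (fun j => by fun_prop) hv0 hv1
    (fun j => hasSubgaussianMGF_weighted_sum (hm j) (hsub j) hw2)
    (fun j => (integral_weighted_sum_sq (hm j) (hsub j) hw2).trans (hv j))

theorem mainTheorem3 (ρ : ℝ) (hρ : 0 < ρ) :
    ∃ β : ℝ, 0 < β ∧
      ∀ δ : ℝ, 0 < δ → δ < 1 →
        ∃ L₀ : ℝ,
          ∀ (d : ℕ) (D : Measure (EuclideanSpace ℝ (Fin d))),
            IsProbabilityMeasure D →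
            IsIndepSubGaussian D ρ →
            (1 - covMatrix D).PosSemidef →
            L₀ ≤ (covMatrix D).trace →
            ∀ (m : ℕ) (hm : 1 ≤ m),
              (m : ℝ) ≤ β * (covMatrix D).trace →
              1 - δ ≤ (Measure.pi (fun _ : Fin m => D)).real
                {x | (m : ℝ) ≤
                  kthLargestEigenvalue (gramMatrix_isHermitian x) m ⟨hm, le_rfl⟩} := by
  have hc := tailRate_pos hρ
  have hlog : 0 < Real.log 9 := Real.log_pos (by norm_num)
  -- The first bound on `β` gives `m ≤ L/18`; the second makes `9^m ≤ exp (cL/2)`, using half of the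
  -- exponent `cL`. The choice of `L₀` makes the other half give `2 exp (-cL/2) ≤ δ`.
  refine ⟨min (1 / 18) (tailRate ρ / (2 * Real.log 9)), by positivity, fun δ hδ _ =>
    ⟨2 / tailRate ρ * Real.log (2 / δ), fun d D hD ⟨a, hind, hrel⟩ hcov hL₀ m hm hmL => ?_⟩⟩
  set c := tailRate ρ
  set v : Fin d → ℝ := fun j => ∫ x, (inner ℝ x (a j)) ^ 2 ∂D
  have hv0 : ∀ j, 0 ≤ v j := fun j => integral_nonneg fun _ => sq_nonneg _
  have hsub : ∀ j, HasSubgaussianMGF (fun x => inner ℝ x (a j)) (ρ ^ 2 * v j).toNNReal D := by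
    intro j
    obtain ⟨B, hB, hB0, h⟩ := hrel j
    convert h using 1
    rw [← Real.toNNReal_pow hB0, hB, mul_pow, Real.sq_sqrt (hv0 j)]
  have ha : ∀ j, MemLp (fun x => inner ℝ x (a j)) 2 D := fun j => (hsub j).memLp 2
  -- Integrability and centring are known only in the basis `a`; this transfers them to the standard
  -- coordinates that define `covMatrix`.
  have hcoord : ∀ i, (fun x : EuclideanSpace ℝ (Fin d) => x i)
      = fun x => ∑ j, a j i * inner ℝ x (a j) := fun i => by
    ext x
    conv_lhs => rw [← a.sum_repr' x]
    simp [real_inner_comm, mul_comm]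
  have hX : ∀ i, MemLp (fun x : EuclideanSpace ℝ (Fin d) => x i) 2 D := fun i => by
    rw [hcoord]
    exact memLp_finsetSum _ fun j _ => (ha j).const_mul _
  have hX0 : ∀ i, ∫ x, x i ∂D = 0 := fun i => by
    rw [hcoord, integral_finsetSum _ fun j _ => (hsub j).integrable.const_mul _]
    refine Finset.sum_eq_zero fun j _ => ?_
    rw [integral_const_mul, (hsub j).integral_eq_zero, mul_zero]
  have hv1 : ∀ j, v j ≤ 1 := fun j => by
    have := variance_inner_le_one hcov hX (a.orthonormal.1 j)
    rwa [variance_of_integral_eq_zero (ha j).aemeasurable (hsub j).integral_eq_zero] at this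
  have htr : (covMatrix D).trace = ∑ j, v j := trace_covMatrix a hX hX0 ha
  rw [htr] at hL₀ hmL
  set L := ∑ j, v j
  have hLnn : 0 ≤ L := Finset.sum_nonneg fun j _ => hv0 j
  have hm18 : (m : ℝ) ≤ L / 18 := hmL.trans <| by
    have := mul_le_mul_of_nonneg_right (min_le_left (1 / 18) (c / (2 * Real.log 9))) hLnn
    linarith
  have hmlog : m * Real.log 9 ≤ c * L / 2 := by
    have h1 := mul_le_mul_of_nonneg_right (min_le_right (1 / 18) (c / (2 * Real.log 9))) hLnn
    have h2 := mul_le_mul_of_nonneg_right (hmL.trans h1) hlog.le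
    refine h2.trans (le_of_eq ?_)
    field_simp
  obtain ⟨N, hNcard, hNunit, hNnet⟩ := exists_sphere_net (EuclideanSpace ℝ (Fin m))
  rw [finrank_euclideanSpace_fin] at hNcard
  set P := Measure.pi fun _ : Fin m => D
  let U : EuclideanSpace ℝ (Fin m) → Set (Fin m → EuclideanSpace ℝ (Fin d)) := fun w =>
    {x | 2 * L ≤ ‖sampleMap x w‖ ^ 2} ∪ {x | ‖sampleMap x w‖ ^ 2 ≤ L / 2}
  have hU : ∀ w ∈ N, P.real (U w) ≤ 2 * Real.exp (-(c * L)) := fun w hw => by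
    obtain ⟨h1, h2⟩ := measureReal_norm_sampleMap_tails hρ hind (fun _ => rfl) hv1 hsub
      (hNunit w hw)
    exact (measureReal_union_le _ _).trans (by linarith)
  have hmeas : ∀ w, MeasurableSet (U w) := fun w => by
    have hf : Measurable fun x : Fin m → EuclideanSpace ℝ (Fin d) => ‖sampleMap x w‖ ^ 2 := by
      simp only [sampleMap_apply]
      fun_prop
    exact (measurableSet_le measurable_const hf).union (measurableSet_le hf measurable_const)
  have hbad : P.real (⋃ w ∈ N, U w) ≤ δ := by
    calc P.real (⋃ w ∈ N, U w) ≤ ∑ w ∈ N, P.real (U w) := measureReal_biUnion_finset_le _ _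
      _ ≤ ∑ w ∈ N, 2 * Real.exp (-(c * L)) := Finset.sum_le_sum hU
      _ = N.card * (2 * Real.exp (-(c * L))) := by simp
      _ ≤ (9 : ℝ) ^ m * (2 * Real.exp (-(c * L))) := by gcongr; exact mod_cast hNcard
      _ = 2 * Real.exp (m * Real.log 9 - c * L) := by
          rw [sub_eq_add_neg, Real.exp_add, mul_comm (m : ℝ), Real.exp_mul,
            Real.exp_log (by norm_num), Real.rpow_natCast]
          ring
      _ ≤ 2 * Real.exp (-Real.log (2 / δ)) := by
          have : Real.log (2 / δ) ≤ c * L / 2 := by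
            have := mul_le_mul_of_nonneg_left hL₀ (show 0 ≤ c / 2 by positivity)
            have h2 : c / 2 * (2 / c * Real.log (2 / δ)) = Real.log (2 / δ) := by field_simp
            linarith
          gcongr
          linarith
      _ = δ := by
          rw [Real.exp_neg, Real.exp_log (by positivity)]
          field_simp
  have hgood : P.real (⋃ w ∈ N, U w)ᶜ ≤ P.real {x | (m : ℝ) ≤
      kthLargestEigenvalue (gramMatrix_isHermitian x) m ⟨hm, le_rfl⟩} := by
    refine measureReal_mono fun x hx => ?_
    simp only [Set.mem_compl_iff, Set.mem_iUnion, not_exists, U, Set.mem_union, Set.mem_ofPred_eq,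
      not_or, not_le] at hx
    refine le_kthLargestEigenvalue_gramMatrix x _ fun w hw => hm18.trans ?_
    exact le_norm_sq_of_net (sampleMap x) (N := N) hNnet (fun v hv => (hx v hv).1.le)
      (fun v hv => (hx v hv).2.le) hw
  rw [probReal_compl_eq_one_sub (Finset.measurableSet_biUnion _ fun w _ => hmeas w)] at hgood
  linarith
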